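/- Let $n\ge 2$ and $m\ge 1$ be integers and let $T>0$, $\sigma>0$. Let $A\in\mathbb{R}^{m\times n}$ be the heat kernel matrix whose entry for sensor $j\in\{1,\dots,m\}$ and source location $i\in\{1,\dots,n\}$ is $g\left(\frac{i}{n}-\frac{j}{m}\right)$, where $g(x)=\frac{1}{\sqrt{4\pi T}}e^{-|x|^2/(4T)}$. A source vector is a vector $f_0\in[0,1]^n$ with $\|f_0\|_1=1$, regarded as a probability distribution on $\{\frac1n,\frac2n,\dots,1\}$, and its measurement vector is $\tilde y\sim Af_0+N(0,\sigma^2I_m)$. For two probability vectors $p,q$ on $\{\frac1n,\dots,1\}$ let $$\mathrm{EMD}(p,q)=\min\Big\{\sum_{i,j}\mathfrak f_{ij}\Big|\frac in-\frac jn\Big| \;:\; \mathfrak f\in[0,1]^{n\times n},\ \sum_j\mathfrak f_{ij}\le p_i\ \forall i,\ \sum_i\mathfrak f_{ij}\le q_j\ \forall j,\ \sum_{i,j}\mathfrak f_{ij}=1\Big\}.$$ Then $$\inf_{\hat f}\ \sup_{f_0}\ \mathbb{E}\left[\mathrm{EMD}\left(f_0,\frac{\hat f(\tilde y)}{\|\hat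 f(\tilde y)\|_1}\right)\right]=\Omega\left(\min\left\{\frac12,\ \frac{T^{1.5}\sigma}{\sqrt m}\right\}\right),$$ where the infimum is over all measurable estimators $\hat f:\mathbb{R}^m\to[0,1]^n$, the supremum is over all source vectors $f_0$, and the error is $+\infty$ where $\hat f(\tilde y)=0$. That is, there is an absolute constant $c>0$ (independent of $n,m,T,\sigma$) such that for all $n\ge2$, $m\ge1$, $T>0$, $\sigma>0$ the left-hand side is at least $c\min\{\frac12, T^{1.5}\sigma/\sqrt m\}$. -/

import Mathlib

open MeasureTheory ProbabilityTheory
open scoped ENNReal Matrix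

noncomputable section

namespace HeatSource

/-- The location `i / k` of the `i`-th of the `k` points `1/k, 2/k, …, 1` (indices of `Fin k`
start at `0`, hence the `+ 1`). -/
def loc {k : ℕ} (i : Fin k) : ℝ := ((i : ℝ) + 1) / k

/-- The one-dimensional heat kernel with `T = (diffusion constant) * (time)`. -/
def heatKernel (T x : ℝ) : ℝ := 1 / √(4 * Real.pi * T) * Real.exp (-|x| ^ 2 / (4 * T))

/-- The `m × n` measurement matrix: row = sensor at `s / m`, column = source location `i / n`. -/
def heatMatrix (m n : ℕ) (T : ℝ) : Matrix (Fin m) (Fin n) ℝ :=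
  Matrix.of fun s i => heatKernel T (loc i - loc s)

/-- Feasible flows from `p` to `q` in the definition of the Earth Mover Distance. -/
structure IsFlow {n : ℕ} (p q : Fin n → ℝ) (f : Fin n → Fin n → ℝ) : Prop where
  mem_Icc : ∀ i j, f i j ∈ Set.Icc (0 : ℝ) 1
  row_le : ∀ i, ∑ j, f i j ≤ p i
  col_le : ∀ j, ∑ i, f i j ≤ q j
  total : ∑ i, ∑ j, f i j = 1

/-- The Earth Mover Distance between two probability vectors on `{1/n, …, 1}` with the metric
`|x - y|`: the least cost of a feasible flow (`∞` if there is no feasible flow). -/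
def emd {n : ℕ} (p q : Fin n → ℝ) : ℝ≥0∞ :=
  ⨅ (f : Fin n → Fin n → ℝ) (_ : IsFlow p q f),
    ENNReal.ofReal (∑ i, ∑ j, f i j * |loc i - loc j|)

/-- `f / ‖f‖₁`. This is `f` itself if `‖f‖₁ = 1`. The zero vector is sent to `0`, and then
`emd p 0 = ∞`. -/
def l1Normalize {n : ℕ} (f : Fin n → ℝ) : Fin n → ℝ := fun i => f i / ∑ j, |f j|

/-- The law of `A f₀ + N(0, σ² I_m)`: independent Gaussian coordinates with means `(A f₀) s`
and variance `σ²`. -/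
def measurementLaw {n : ℕ} (m : ℕ) (T σ : ℝ) (f₀ : Fin n → ℝ) : Measure (Fin m → ℝ) :=
  Measure.pi fun s => gaussianReal ((heatMatrix m n T *ᵥ f₀) s) ⟨σ ^ 2, sq_nonneg σ⟩

/-- Estimators: (Borel measurable) maps `ℝ^m → [0,1]^n`. -/
structure Estimator (m n : ℕ) where
  toFun : (Fin m → ℝ) → (Fin n → ℝ)
  measurable : Measurable toFun
  mem_Icc : ∀ y i, toFun y i ∈ Set.Icc (0 : ℝ) 1

/-- The expected EMD error `E[EMD(f₀, f̂ / ‖f̂‖₁)]` of the estimator `f̂` at the source `f₀`. -/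
def risk {m n : ℕ} (T σ : ℝ) (fhat : Estimator m n) (f₀ : Fin n → ℝ) : ℝ≥0∞ :=
  ∫⁻ y, emd f₀ (l1Normalize (fhat.toFun y)) ∂(measurementLaw m T σ f₀)

/-- Infimum over all estimators of the supremum, over all source vectors (probability vectors
in `[0,1]^n`), of the expected EMD error. -/
def minimaxRisk (m n : ℕ) (T σ : ℝ) : ℝ≥0∞ :=
  ⨅ fhat : Estimator m n, ⨆ f₀ ∈ stdSimplex ℝ (Fin n), risk T σ fhat f₀

end HeatSource

end

open MeasureTheory ProbabilityTheory
open scoped ENNReal NNReal Matrix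

/-! This is Le Cam's two-point method. One source is a unit mass at `1/n`; the other moves mass `δ`
from there to `1`. Transport cost dominates the difference of means (`ofReal_abs_sub_le_emd`), so
the sources are at least `δ/2` apart. All kernel arguments lie in `[-1, 1]`, where the kernel
oscillates by at most `T^(-3/2)` (`sq_heatKernel_sub_le`), so the squared distance between the
noiseless measurements is at most `mδ²/T³`. When this is at most `σ²`, no test separates the two
laws (`pi_gaussianReal_le`), and any estimator errs by order `δ` on one source. -/

namespace HeatSource

/-! ### Likelihood ratios of shifted Gaussians -/

section Gaussian

/-- The likelihood ratio of `N(a + d, v)` against `N(a, v)`. -/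
noncomputable def gaussianRatio (a d : ℝ) (v : ℝ≥0) (x : ℝ) : ℝ≥0∞ :=
  ENNReal.ofReal (Real.exp (d * (x - a) / v - d ^ 2 / (2 * v)))

lemma measurable_gaussianRatio (a d : ℝ) (v : ℝ≥0) : Measurable (gaussianRatio a d v) := by
  unfold gaussianRatio
  fun_prop

lemma gaussianReal_add_eq_withDensity (a d : ℝ) {v : ℝ≥0} (hv : v ≠ 0) :
    gaussianReal (a + d) v = (gaussianReal a v).withDensity (gaussianRatio a d v) := by
  rw [gaussianReal_of_var_ne_zero _ hv, gaussianReal_of_var_ne_zero _ hv,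
    ← withDensity_mul _ (measurable_gaussianPDF _ _) (measurable_gaussianRatio _ _ _)]
  congr 1
  ext x
  have hv' : (v : ℝ) ≠ 0 := by exact_mod_cast hv
  simp only [gaussianPDF, gaussianPDFReal, gaussianRatio, Pi.mul_apply]
  rw [← ENNReal.ofReal_mul (by positivity), mul_assoc _ (Real.exp _) (Real.exp _),
    ← Real.exp_add]
  congr 3
  field_simp
  ring

/-- Squaring the ratio for shift `d` gives a constant times the ratio for shift `2d`, which
integrates to one. -/
lemma lintegral_gaussianRatio_sq (a d : ℝ) {v : ℝ≥0} (hv : v ≠ 0) :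
    ∫⁻ x, gaussianRatio a d v x ^ 2 ∂(gaussianReal a v) =
      ENNReal.ofReal (Real.exp (d ^ 2 / v)) := by
  have hv' : (v : ℝ) ≠ 0 := by exact_mod_cast hv
  have hsq : ∀ x, gaussianRatio a d v x ^ 2 =
      ENNReal.ofReal (Real.exp (d ^ 2 / v)) * gaussianRatio a (2 * d) v x := by
    intro x
    unfold gaussianRatio
    rw [← ENNReal.ofReal_pow (by positivity), ← ENNReal.ofReal_mul (by positivity),
      ← Real.exp_add, ← Real.exp_nat_mul]
    congr 2
    push_cast
    field_simp
    ring
  have hone : ∫⁻ x, gaussianRatio a (2 * d) v x ∂(gaussianReal a v) = 1 := by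
    have h : gaussianReal (a + 2 * d) v Set.univ = 1 := measure_univ
    rwa [gaussianReal_add_eq_withDensity a (2 * d) hv, withDensity_apply _ MeasurableSet.univ,
      setLIntegral_univ] at h
  simp_rw [hsq]
  rw [lintegral_const_mul _ (measurable_gaussianRatio _ _ _), hone, mul_one]

end Gaussian

/-! ### Product measures and indistinguishability -/

section Product

variable {ι : Type*} [Fintype ι] {X : ι → Type*} [∀ i, MeasurableSpace (X i)]

lemma lintegral_pi_prod (μ : ∀ i, Measure (X i)) [∀ i, IsProbabilityMeasure (μ i)]
    {f : ∀ i, X i → ℝ≥0∞} (hf : ∀ i, Measurable (f i)) :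
    ∫⁻ x, ∏ i, f i (x i) ∂(Measure.pi μ) = ∏ i, ∫⁻ x, f i x ∂(μ i) := by
  have hind : iIndepFun (fun i (x : ∀ i, X i) => f i (x i)) (Measure.pi μ) :=
    iIndepFun_pi (fun i => (hf i).aemeasurable)
  have h := lintegral_prod_eq_prod_lintegral_of_indepFun Finset.univ _ hind
    (fun i => (hf i).comp (measurable_pi_apply i))
  rw [h]
  refine Finset.prod_congr rfl fun i _ => ?_
  exact (measurePreserving_eval μ i).lintegral_comp (hf i)

lemma pi_withDensity_eq (μ : ∀ i, Measure (X i)) [∀ i, IsProbabilityMeasure (μ i)]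
    {f : ∀ i, X i → ℝ≥0∞} (hf : ∀ i, Measurable (f i))
    [∀ i, SigmaFinite ((μ i).withDensity (f i))] :
    Measure.pi (fun i => (μ i).withDensity (f i)) =
      (Measure.pi μ).withDensity (fun x => ∏ i, f i (x i)) := by
  refine Measure.pi_eq fun s hs => ?_
  rw [withDensity_apply _ (MeasurableSet.univ_pi hs), ← lintegral_indicator
    (MeasurableSet.univ_pi hs)]
  have h : ∀ x : ∀ i, X i, (Set.univ.pi s).indicator (fun x => ∏ i, f i (x i)) x =
      ∏ i, (s i).indicator (f i) (x i) := by
    intro x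
    by_cases hx : x ∈ Set.univ.pi s
    · rw [Set.indicator_of_mem hx]
      exact Finset.prod_congr rfl fun i _ => (Set.indicator_of_mem (hx i trivial) _).symm
    · rw [Set.indicator_of_notMem hx]
      simp only [Set.mem_pi, Set.mem_univ, true_implies, not_forall] at hx
      obtain ⟨i, hi⟩ := hx
      exact (Finset.prod_eq_zero (Finset.mem_univ i) (Set.indicator_of_notMem hi _)).symm
  simp_rw [h]
  rw [lintegral_pi_prod μ (fun i => (hf i).indicator (hs i))]
  refine Finset.prod_congr rfl fun i _ => ?_
  rw [lintegral_indicator (hs i), withDensity_apply _ (hs i)]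

/-- If the `χ²`-type distance between two Gaussian product measures is at most one, the measures
cannot be told apart by a test. -/
lemma pi_gaussianReal_le (a d : ι → ℝ) {v : ℝ≥0} (hv : v ≠ 0)
    (hd : ∑ i, d i ^ 2 / v ≤ 1) {E : Set (ι → ℝ)} (hE : MeasurableSet E) :
    Measure.pi (fun i => gaussianReal (a i + d i) v) E ≤
      4 * Measure.pi (fun i => gaussianReal (a i) v) E + 1 / 4 := by
  set P := Measure.pi (fun i => gaussianReal (a i) v)
  set L : (ι → ℝ) → ℝ≥0∞ := fun x => ∏ i, gaussianRatio (a i) (d i) v (x i) with hL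
  have hLm : Measurable L := Finset.measurable_prod _ fun i _ =>
    (measurable_gaussianRatio _ _ _).comp (measurable_pi_apply i)
  have hQ : Measure.pi (fun i => gaussianReal (a i + d i) v) = P.withDensity L := by
    have hprob : ∀ i, SigmaFinite
        ((gaussianReal (a i) v).withDensity (gaussianRatio (a i) (d i) v)) := fun i => by
      rw [← gaussianReal_add_eq_withDensity _ _ hv]
      infer_instance
    simp_rw [gaussianReal_add_eq_withDensity _ _ hv]
    exact pi_withDensity_eq _ fun i => measurable_gaussianRatio _ _ _
  have hL2 : ∫⁻ x, L x ^ 2 ∂P ≤ 4 := by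
    have h1 : ∫⁻ x, L x ^ 2 ∂P = ENNReal.ofReal (Real.exp (∑ i, d i ^ 2 / v)) := by
      simp_rw [hL, ← Finset.prod_pow]
      rw [lintegral_pi_prod _ (fun i => (measurable_gaussianRatio (a i) (d i) v).pow_const 2)]
      simp_rw [lintegral_gaussianRatio_sq _ _ hv]
      rw [Real.exp_sum, ENNReal.ofReal_prod_of_nonneg fun i _ => (Real.exp_pos _).le]
    rw [h1]
    refine (ENNReal.ofReal_le_ofReal (?_ : _ ≤ (4 : ℝ))).trans (by simp)
    exact (Real.exp_le_exp.2 hd).trans (by linarith [Real.exp_one_lt_d9])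
  -- This is `(L - 8)² ≥ 0`. With second moment at most 4, the quadratic term contributes at most
  -- 1/4.
  have hpt : ∀ x, L x ≤ 4 + 1 / 16 * L x ^ 2 := by
    intro x
    rcases eq_or_ne (L x) ∞ with h | h
    · simp [h]
    · lift L x to ℝ≥0 using h with l
      have : (l : ℝ) ≤ 4 + 1 / 16 * l ^ 2 := by nlinarith [sq_nonneg ((l : ℝ) - 8)]
      have h' : l ≤ 4 + 1 / 16 * l ^ 2 := by exact_mod_cast this
      have h16 : (1 / 16 : ℝ≥0∞) = ((1 / 16 : ℝ≥0) : ℝ≥0∞) := by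
        rw [ENNReal.coe_div (by norm_num)]
        norm_num
      rw [h16]
      exact_mod_cast h'
  rw [hQ, withDensity_apply _ hE]
  calc ∫⁻ x in E, L x ∂P ≤ ∫⁻ x in E, (4 + 1 / 16 * L x ^ 2) ∂P := lintegral_mono hpt
    _ = 4 * P E + 1 / 16 * ∫⁻ x in E, L x ^ 2 ∂P := by
        rw [lintegral_add_left measurable_const, setLIntegral_const,
          lintegral_const_mul _ (hLm.pow_const 2)]
    _ ≤ 4 * P E + 1 / 16 * 4 := by
        gcongr
        exact (setLIntegral_le_lintegral _ _).trans hL2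
    _ = 4 * P E + 1 / 4 := by
        congr 1
        rw [← ENNReal.toReal_eq_toReal_iff' (by finiteness) (by finiteness)]
        norm_num

end Product

/-! ### Lower bound for the Earth Mover Distance -/

section EarthMover

variable {n : ℕ}

/-- A flow of total mass one saturates every row and column constraint, so its marginals are `p` and
`q`; the triangle inequality finishes. Allowing `∑ q < 1` covers the normalized zero vector. -/
lemma ofReal_abs_sub_le_emd {p q : Fin n → ℝ} (hp : ∑ i, p i = 1) (hq : ∑ i, q i ≤ 1) :
    ENNReal.ofReal |∑ i, p i * loc i - ∑ i, q i * loc i| ≤ emd p q := by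
  refine le_iInf₂ fun f hf => ENNReal.ofReal_le_ofReal ?_
  have hrow : ∀ i, ∑ j, f i j = p i := by
    have h := (Finset.sum_eq_sum_iff_of_le fun i _ => hf.row_le i).1 (hf.total.trans hp.symm)
    exact fun i => h i (Finset.mem_univ i)
  have htot : ∑ j, ∑ i, f i j = 1 := by rw [Finset.sum_comm]; exact hf.total
  have hcol : ∀ j, ∑ i, f i j = q j := by
    have hle : ∑ j, ∑ i, f i j ≤ ∑ j, q j := Finset.sum_le_sum fun j _ => hf.col_le j
    have h := (Finset.sum_eq_sum_iff_of_le fun j _ => hf.col_le j).1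
      (le_antisymm hle (by linarith))
    exact fun i => h i (Finset.mem_univ i)
  have h1 : ∑ i, p i * loc i - ∑ i, q i * loc i = ∑ i, ∑ j, f i j * (loc i - loc j) := by
    simp_rw [mul_sub, Finset.sum_sub_distrib]
    rw [Finset.sum_comm (f := fun i j => f i j * loc j)]
    simp_rw [← Finset.sum_mul, hrow, hcol]
  rw [h1]
  refine (Finset.abs_sum_le_sum_abs _ _).trans (Finset.sum_le_sum fun i _ => ?_)
  refine (Finset.abs_sum_le_sum_abs _ _).trans (Finset.sum_le_sum fun j _ => ?_)
  rw [abs_mul, abs_of_nonneg (hf.mem_Icc i j).1]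

lemma sum_l1Normalize_le_one (f : Fin n → ℝ) : ∑ i, l1Normalize f i ≤ 1 := by
  unfold l1Normalize
  rw [← Finset.sum_div]
  exact (div_le_div_of_nonneg_right (Finset.sum_le_sum fun i _ => le_abs_self (f i))
    (Finset.sum_nonneg fun i _ => abs_nonneg (f i))).trans (div_self_le_one _)

lemma loc_mem_Icc {k : ℕ} (i : Fin k) : loc i ∈ Set.Icc (0 : ℝ) 1 := by
  have hk : (0 : ℝ) < k := by exact_mod_cast i.pos
  have hi : (i : ℝ) + 1 ≤ k := by exact_mod_cast i.isLt
  exact ⟨by unfold loc; positivity, (div_le_one hk).2 hi⟩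

end EarthMover

/-! ### Oscillation of the heat kernel -/

section Kernel

lemma abs_exp_neg_sub_exp_neg_le {a b r : ℝ} (ha : a ∈ Set.Icc 0 r) (hb : b ∈ Set.Icc 0 r) :
    |Real.exp (-a) - Real.exp (-b)| ≤ r := by
  have key : ∀ {a b : ℝ}, a ∈ Set.Icc 0 r → b ∈ Set.Icc 0 r →
      Real.exp (-a) - Real.exp (-b) ≤ r := by
    intro a b ha hb
    rcases le_or_gt 1 r with hr | hr
    · linarith [Real.exp_le_one_iff.2 (neg_nonpos.2 ha.1), Real.exp_pos (-b)]
    · linarith [Real.exp_le_one_iff.2 (neg_nonpos.2 ha.1), Real.add_one_le_exp (-b), hb.2]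
  exact abs_le.2 ⟨by linarith [key hb ha], key ha hb⟩

lemma abs_heatKernel_sub_le {T x y : ℝ} (hT : 0 < T) (hx : |x| ≤ 1) (hy : |y| ≤ 1) :
    |heatKernel T x - heatKernel T y| ≤ 1 / √(4 * Real.pi * T) * (1 / (4 * T)) := by
  unfold heatKernel
  rw [← mul_sub, abs_mul, abs_of_nonneg (by positivity : 0 ≤ 1 / √(4 * Real.pi * T))]
  refine mul_le_mul_of_nonneg_left ?_ (by positivity)
  rw [neg_div, neg_div]
  have key : ∀ z : ℝ, |z| ≤ 1 → |z| ^ 2 / (4 * T) ∈ Set.Icc 0 (1 / (4 * T)) := fun z hz =>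
    ⟨by positivity, div_le_div_of_nonneg_right (pow_le_one₀ (abs_nonneg z) hz) (by positivity)⟩
  exact abs_exp_neg_sub_exp_neg_le (key x hx) (key y hy)

lemma sq_heatKernel_sub_le {T x y : ℝ} (hT : 0 < T) (hx : |x| ≤ 1) (hy : |y| ≤ 1) :
    (heatKernel T x - heatKernel T y) ^ 2 ≤ 1 / T ^ 3 := by
  have h := pow_le_pow_left₀ (abs_nonneg _) (abs_heatKernel_sub_le hT hx hy) 2
  rw [sq_abs] at h
  refine h.trans ?_
  rw [mul_pow, div_pow, Real.sq_sqrt (by positivity), div_pow, div_mul_div_comm]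
  have hpi := Real.pi_gt_three
  rw [div_le_div_iff₀ (by positivity) (by positivity)]
  have : 0 < T ^ 3 := by positivity
  nlinarith

end Kernel

/-! ### The two-point argument -/

section TwoPoint

variable {n m : ℕ}

/-- Le Cam's two-point bound for the minimax risk. -/
lemma le_minimaxRisk_of_pair {T σ D : ℝ} (hσ : 0 < σ) (hD : 0 ≤ D) {p q : Fin n → ℝ}
    (hp : p ∈ stdSimplex ℝ (Fin n)) (hq : q ∈ stdSimplex ℝ (Fin n))
    (hpq : D ≤ |∑ i, p i * loc i - ∑ i, q i * loc i|)
    (hA : ∑ s, ((heatMatrix m n T *ᵥ q) s - (heatMatrix m n T *ᵥ p) s) ^ 2 / σ ^ 2 ≤ 1) :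
    ENNReal.ofReal (D / 32) ≤ minimaxRisk m n T σ := by
  refine le_iInf fun fhat => ?_
  set M := ⨆ f₀ ∈ stdSimplex ℝ (Fin n), risk T σ fhat f₀
  set φ : (Fin n → ℝ) → ℝ := fun h => ∑ i, h i * loc i with hφ
  set g : (Fin m → ℝ) → ℝ := fun y => φ (l1Normalize (fhat.toFun y)) with hg
  have hgm : Measurable g := by
    have := fhat.measurable
    simp only [hg, hφ, l1Normalize]
    fun_prop
  -- On `E` the estimated mean is far from that of `p`; off `E` it is far from that of `q`.
  set E : Set (Fin m → ℝ) := {y | D / 2 ≤ |φ p - g y|} with hE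
  have hEm : MeasurableSet E := measurableSet_le measurable_const (by fun_prop)
  have hrisk : ∀ f₀ ∈ stdSimplex ℝ (Fin n), ∀ S : Set (Fin m → ℝ), MeasurableSet S →
      (∀ y ∈ S, D / 2 ≤ |φ f₀ - g y|) →
      ENNReal.ofReal (D / 2) * measurementLaw m T σ f₀ S ≤ M := by
    intro f₀ hf₀ S hS hy
    calc ENNReal.ofReal (D / 2) * measurementLaw m T σ f₀ S
        = ∫⁻ y, S.indicator (fun _ => ENNReal.ofReal (D / 2)) y ∂(measurementLaw m T σ f₀) := by
          rw [lintegral_indicator hS, setLIntegral_const]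
      _ ≤ risk T σ fhat f₀ := by
          refine lintegral_mono fun y => ?_
          refine Set.indicator_apply_le' (fun h => ?_) (fun _ => zero_le)
          exact (ENNReal.ofReal_le_ofReal (hy y h)).trans
            (ofReal_abs_sub_le_emd hf₀.2 (sum_l1Normalize_le_one _))
      _ ≤ M := le_iSup₂ (f := fun f₀ (_ : f₀ ∈ stdSimplex ℝ (Fin n)) => risk T σ fhat f₀) f₀ hf₀
  have hP := hrisk p hp E hEm fun y hy => hy
  have hQ := hrisk q hq Eᶜ hEm.compl fun y hy => by
    have h1 : |φ p - g y| < D / 2 := not_le.1 hy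
    have h2 : |φ p - φ q| ≤ |φ p - g y| + |g y - φ q| := abs_sub_le _ _ _
    rw [abs_sub_comm (g y)] at h2
    linarith
  have hv : (⟨σ ^ 2, sq_nonneg σ⟩ : ℝ≥0) ≠ 0 := by
    intro h
    exact (pow_pos hσ 2).ne' (congrArg NNReal.toReal h)
  have htest := pi_gaussianReal_le (fun s => (heatMatrix m n T *ᵥ p) s)
    (fun s => (heatMatrix m n T *ᵥ q) s - (heatMatrix m n T *ᵥ p) s) hv hA hEm
  simp only [add_sub_cancel] at htest
  change measurementLaw m T σ q E ≤ 4 * measurementLaw m T σ p E + 1 / 4 at htest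
  have hprob : ∀ f₀ : Fin n → ℝ, IsProbabilityMeasure (measurementLaw m T σ f₀) := fun f₀ => by
    have h : ∀ s, IsProbabilityMeasure
        (gaussianReal ((heatMatrix m n T *ᵥ f₀) s) ⟨σ ^ 2, sq_nonneg σ⟩) :=
      fun s => instIsProbabilityMeasureGaussianReal _ _
    exact Measure.pi.instIsProbabilityMeasure _
  have hQE : measurementLaw m T σ q Eᶜ = 1 - measurementLaw m T σ q E := prob_compl_eq_one_sub hEm
  rcases eq_or_ne M ∞ with hM | hM
  · simp [hM]
  have hfin : ∀ (f₀ : Fin n → ℝ) (S : Set (Fin m → ℝ)), measurementLaw m T σ f₀ S ≠ ∞ :=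
    fun f₀ S => measure_ne_top _ _
  have hP' := ENNReal.toReal_mono hM hP
  have hQ' := ENNReal.toReal_mono hM hQ
  have ht' := ENNReal.toReal_mono (by finiteness) htest
  rw [ENNReal.toReal_mul, ENNReal.toReal_ofReal (by positivity)] at hP' hQ'
  rw [ENNReal.toReal_add (by finiteness) (by finiteness), ENNReal.toReal_mul] at ht'
  rw [hQE, ENNReal.toReal_sub_of_le prob_le_one (by simp)] at hQ'
  norm_num at ht' hQ'
  rw [← ENNReal.ofReal_toReal hM]
  refine ENNReal.ofReal_le_ofReal ?_
  -- Four times `hP'` plus `hQ'`, with `ht'`, gives `5M ≥ (D/2)(3/4)`, hence `M ≥ 3D/40 ≥ D/32`.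
  nlinarith [mul_le_mul_of_nonneg_left ht' (by positivity : 0 ≤ D / 2),
    ENNReal.toReal_nonneg (a := M)]

lemma le_minimaxRisk {T σ δ : ℝ} (hn : 2 ≤ n) (hT : 0 < T) (hσ : 0 < σ) (hδ0 : 0 ≤ δ)
    (hδ1 : δ ≤ 1) (hδ : m * δ ^ 2 ≤ T ^ 3 * σ ^ 2) :
    ENNReal.ofReal (δ / 64) ≤ minimaxRisk m n T σ := by
  let a : Fin n := ⟨0, by omega⟩
  let b : Fin n := ⟨n - 1, by omega⟩
  set p : Fin n → ℝ := Pi.single a 1 with hp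
  set q : Fin n → ℝ := (1 - δ) • Pi.single a 1 + δ • Pi.single b 1 with hq
  have hpm : p ∈ stdSimplex ℝ (Fin n) := single_mem_stdSimplex ℝ a
  have hqm : q ∈ stdSimplex ℝ (Fin n) :=
    convex_stdSimplex ℝ (Fin n) hpm (single_mem_stdSimplex ℝ b) (by linarith) hδ0 (by ring)
  have hloc : loc b - loc a = 1 - 1 / n := by
    have hn0 : (n : ℝ) ≠ 0 := by positivity
    simp only [loc, a, b, Nat.cast_sub (by omega : 1 ≤ n)]
    field_simp
    push_cast
    ring
  have hgap : 1 / 2 ≤ loc b - loc a := by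
    rw [hloc]
    have : (1 : ℝ) / n ≤ 1 / 2 := one_div_le_one_div_of_le (by norm_num) (by exact_mod_cast hn)
    linarith
  have hφ : ∑ i, p i * loc i - ∑ i, q i * loc i = -(δ * (loc b - loc a)) := by
    simp only [hp, hq, Pi.add_apply, Pi.smul_apply, smul_eq_mul, add_mul, mul_assoc,
      Finset.sum_add_distrib, ← Finset.mul_sum, Pi.single_apply, ite_mul, one_mul, zero_mul,
      Finset.sum_ite_eq', Finset.mem_univ, if_true]
    ring
  have hdiff : ∀ s, (heatMatrix m n T *ᵥ q) s - (heatMatrix m n T *ᵥ p) s =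
      δ * (heatKernel T (loc b - loc s) - heatKernel T (loc a - loc s)) := by
    intro s
    simp only [hp, hq, Matrix.mulVec_add, Matrix.mulVec_smul, Matrix.mulVec_single_one,
      Pi.add_apply, Pi.smul_apply, smul_eq_mul, Matrix.col_apply, heatMatrix, Matrix.of_apply]
    ring
  have habs : ∀ (i : Fin n) (s : Fin m), |loc i - loc s| ≤ 1 := fun i s =>
    abs_le.2 ⟨by linarith [(loc_mem_Icc i).1, (loc_mem_Icc s).2],
      by linarith [(loc_mem_Icc i).2, (loc_mem_Icc s).1]⟩
  have hmain := le_minimaxRisk_of_pair (m := m) (T := T) (D := δ / 2) hσ (by positivity) hpm hqm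
    (by
      rw [hφ, abs_neg, abs_of_nonneg (mul_nonneg hδ0 (by linarith))]
      nlinarith)
    (by
      calc _ ≤ ∑ _s : Fin m, δ ^ 2 * (1 / T ^ 3) / σ ^ 2 := by
            refine Finset.sum_le_sum fun s _ => div_le_div_of_nonneg_right ?_ (by positivity)
            rw [hdiff, mul_pow]
            exact mul_le_mul_of_nonneg_left
              (sq_heatKernel_sub_le hT (habs b s) (habs a s)) (by positivity)
        _ = m * δ ^ 2 / (T ^ 3 * σ ^ 2) := by
            rw [Finset.sum_const, Finset.card_univ, Fintype.card_fin, nsmul_eq_mul]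
            field_simp
        _ ≤ 1 := (div_le_one (by positivity)).2 hδ)
  rwa [show δ / 2 / 32 = δ / 64 by ring] at hmain

end TwoPoint

end HeatSource

theorem mainTheorem2 :
    ∃ c : ℝ, 0 < c ∧ ∀ (n m : ℕ) (T σ : ℝ), 2 ≤ n → 1 ≤ m → 0 < T → 0 < σ →
      ENNReal.ofReal (c * min (1 / 2) (T ^ (3 / 2 : ℝ) * σ / √(m : ℝ))) ≤
        HeatSource.minimaxRisk m n T σ := by
  refine ⟨1 / 64, by norm_num, fun n m T σ hn hm hT hσ => ?_⟩
  have hm0 : (0 : ℝ) < m := by exact_mod_cast hm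
  -- `r` is the mass `δ` at which `mδ² = T³σ²`; capping it at `1/2` keeps `δ ≤ 1`.
  set r := T ^ (3 / 2 : ℝ) * σ / √(m : ℝ) with hr
  have hr0 : 0 ≤ r := by positivity
  have hr2 : m * r ^ 2 = T ^ 3 * σ ^ 2 := by
    have hT3 : (T ^ (3 / 2 : ℝ)) ^ 2 = T ^ 3 := by
      rw [← Real.rpow_natCast, ← Real.rpow_mul hT.le, ← Real.rpow_natCast]
      norm_num
    rw [hr, div_pow, mul_pow, hT3, Real.sq_sqrt hm0.le]
    field_simp
  have h0 : 0 ≤ min (1 / 2) r := le_min (by norm_num) hr0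
  rw [one_div_mul_eq_div]
  refine HeatSource.le_minimaxRisk hn hT hσ h0 ((min_le_left _ _).trans (by norm_num)) ?_
  rw [← hr2]
  exact mul_le_mul_of_nonneg_left (pow_le_pow_left₀ h0 (min_le_right _ _) 2) hm0.le
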